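/- Let $\rho\neq\sigma$ be two density matrices (complex, positive semidefinite, trace one) on a finite-dimensional Hilbert space, with the same eigenvalues counted with multiplicity. Let $\|\cdot\|$ be the operator norm, $D_{\mathrm{Tr}}(\rho,\sigma)=\frac12\|\rho-\sigma\|_1=\frac12\operatorname{tr}\sqrt{(\rho-\sigma)^\dagger(\rho-\sigma)}$ the trace distance and $F=\operatorname{tr}\sqrt{\sqrt\rho\,\sigma\sqrt\rho}$ the fidelity. An integrable family of Hermitian matrices $(V_t)_{0\le t\le T}$ *drives $\rho$ to $\sigma$ in time $T\geq 0$* if $U\rho U^\dagger=\sigma$ for the time-ordered exponential $U=\mathrm{Texp}\left(-i\int_0^T V_t\,dt\right)$. The quantum charging distance $D(\rho,\sigma)$ is the infimum of the times $T$ in which some $(V_t)$ with $\|V_t\|=1$ for all $t$ drives $\rho$ to $\sigma$. Then $D(\rho,\sigma)>0$, and the following hold. 1. Let $H$ be a Hermitian matrix, let $(V_t)_{0\le t\le T}$ drive $\rho$ to $\sigma$ in time $T$, and let $v$ be a real number with $\|V_t\|\le v$ for all $t\in[0,T]$. Then $T>0$, and the mean charging power $P=|\operatorname{tr}(H\rho)-\operatorname{tr}(H\sigma)|/T$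 satisfies $$P\le 2\|H\|\,v\,\frac{D_{\mathrm{Tr}}(\rho,\sigma)}{D(\rho,\sigma)}\le 2\|H\|\,v .$$ 2. The first bound is attained: for all $h\ge0$ and $v>0$ there are a Hermitian $H$ with $\|H\|=h$, a time $T$ and a family $(V_t)_{0\le t\le T}$ with $\|V_t\|=v$ for all $t$ that drives $\rho$ to $\sigma$ in time $T$, such that $P=2hv\,D_{\mathrm{Tr}}(\rho,\sigma)/D(\rho,\sigma)$. 3. $\arccos F>0$ and $$\frac{D_{\mathrm{Tr}}(\rho,\sigma)}{D(\rho,\sigma)}\le\frac{\sqrt{1-F^2}}{\arccos F}<1 .$$ -/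

import Mathlib

open scoped Matrix Matrix.Norms.L2Operator MatrixOrder ComplexOrder
open MeasureTheory Set

namespace QuantumCharging

noncomputable section

/-- Density matrices: positive semidefinite with unit trace. -/
def IsDensityMatrix {n : Type*} [Fintype n] (ρ : Matrix n n ℂ) : Prop :=
  ρ.PosSemidef ∧ ρ.trace = 1

/-- `U t = Texp (-i ∫₀ᵗ V_s ds)` for `t ∈ [0, T]`: the propagator `U` is the continuous solution of
`U' = -i V U`, `U 0 = 1`, in integral form, so that `V` may be discontinuous in time. -/
def IsTimeOrderedExp {n : Type*} [Fintype n] [DecidableEq n]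
    (V U : ℝ → Matrix n n ℂ) (T : ℝ) : Prop :=
  ContinuousOn U (Icc 0 T) ∧
    ∀ t ∈ Icc 0 T, U t = 1 - Complex.I • ∫ s in (0 : ℝ)..t, V s * U s

/-- The (possibly time-dependent) Hamiltonian `V` drives the state `ρ` to the state `σ` in
time `T`. -/
structure Drives {n : Type*} [Fintype n] [DecidableEq n]
    (V : ℝ → Matrix n n ℂ) (T : ℝ) (ρ σ : Matrix n n ℂ) : Prop where
  time_nonneg : 0 ≤ T
  integrable : IntegrableOn V (Icc 0 T)
  hermitian : ∀ t ∈ Icc 0 T, (V t).IsHermitian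
  reaches : ∃ U : ℝ → Matrix n n ℂ, IsTimeOrderedExp V U T ∧ U T * ρ * (U T)ᴴ = σ

/-- The quantum charging distance: the minimal time in which a Hamiltonian of operator norm one
drives `ρ` to `σ`. -/
def chargingDistance {n : Type*} [Fintype n] [DecidableEq n] (ρ σ : Matrix n n ℂ) : ℝ :=
  sInf {T : ℝ | ∃ V : ℝ → Matrix n n ℂ, Drives V T ρ σ ∧ ∀ t ∈ Icc 0 T, ‖V t‖ = 1}

/-- The trace norm `‖A‖₁ = tr √(A† A)`. -/
def traceNorm {n : Type*} [Fintype n] [DecidableEq n] (A : Matrix n n ℂ) : ℝ :=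
  (CFC.sqrt (Aᴴ * A)).trace.re

/-- The trace distance. -/
def traceDistance {n : Type*} [Fintype n] [DecidableEq n] (ρ σ : Matrix n n ℂ) : ℝ :=
  (1 / 2) * traceNorm (ρ - σ)

/-- Uhlmann's fidelity `tr √(√ρ σ √ρ)`. -/
def fidelity {n : Type*} [Fintype n] [DecidableEq n] (ρ σ : Matrix n n ℂ) : ℝ :=
  (CFC.sqrt (CFC.sqrt ρ * σ * CFC.sqrt ρ)).trace.re

/-- The expectation value `tr (H ρ)` of the observable `H` in the state `ρ`. -/
def expectation {n : Type*} [Fintype n] (H ρ : Matrix n n ℂ) : ℝ :=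
  (H * ρ).trace.re

/-- The mean charging power. -/
def meanPower {n : Type*} [Fintype n] (H ρ σ : Matrix n n ℂ) (T : ℝ) : ℝ :=
  |expectation H ρ - expectation H σ| / T

end

end QuantumCharging

/-!
The energy difference is at most `2 ‖H‖` times the trace distance, by Hölder's inequality, and the
sign of `ρ - σ` attains this bound. Everything else is about the time.

The propagator `U` of a Hamiltonian of norm at most `v` moves every unit vector along the unit
sphere with speed at most `v`, so in time `T` it turns each of them by an angle of at most `v T`.
Hence, as long as `v T ≤ π`, the chord `‖U - 1‖` is at most that of the angle `v T`, all eigenvalues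
of `U` have an argument of modulus at most `v T`, and the principal logarithm `K` of `U` satisfies
`‖K‖ ≤ v T`: the constant Hamiltonian `K` does as well. The charging distance is therefore the least
norm of a Hermitian `K` for which `exp (-i K)` takes `ρ` to `σ`, a minimum by compactness.

For such a `K`, the vectors `√ρ` and `exp (-i K) √ρ` of the Hilbert–Schmidt space purify `ρ` and `σ`
and have an inner product of real part at least `cos ‖K‖`, which the fidelity dominates. So
`arccos F` is at most the charging distance, and with the Fuchs–van de Graaf inequality the ratio of
the distances is at most `sin θ / θ` at `θ = arccos F`.
-/

namespace QuantumCharging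

variable {m n : Type*} [Fintype m] [Fintype n]

theorem IsDensityMatrix.nonempty {ρ : Matrix n n ℂ} (hρ : IsDensityMatrix ρ) : Nonempty n := by
  by_contra hempty
  rw [not_nonempty_iff] at hempty
  simpa [Matrix.trace] using hρ.2

theorem expectation_sub (H ρ σ : Matrix n n ℂ) :
    expectation H (ρ - σ) = expectation H ρ - expectation H σ := by
  simp [expectation, mul_sub]

/-! ### The Hilbert–Schmidt form -/

/-- The real part of the Hilbert–Schmidt inner product of complex matrices, a positive definite
real bilinear form. It is kept separate from the inner products Mathlib can put on matrices, since
the norm in force here is the operator norm. -/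
noncomputable def hilbertSchmidt : LinearMap.BilinForm ℝ (Matrix m n ℂ) :=
  LinearMap.mk₂ ℝ (fun A B => (Aᴴ * B).trace.re)
    (by simp [Matrix.add_mul]) (by simp) (by simp [Matrix.mul_add]) (by simp)

theorem hilbertSchmidt_apply (A B : Matrix m n ℂ) : hilbertSchmidt A B = (Aᴴ * B).trace.re := rfl

theorem hilbertSchmidt_comm (A B : Matrix m n ℂ) : hilbertSchmidt A B = hilbertSchmidt B A := by
  rw [hilbertSchmidt_apply, hilbertSchmidt_apply, ← Complex.conj_re, ← RCLike.star_def,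
    ← Matrix.trace_conjTranspose, Matrix.conjTranspose_mul, Matrix.conjTranspose_conjTranspose]

theorem hilbertSchmidt_mul_left (X : Matrix m m ℂ) (A B : Matrix m n ℂ) :
    hilbertSchmidt (X * A) B = hilbertSchmidt A (Xᴴ * B) := by
  simp only [hilbertSchmidt_apply, Matrix.conjTranspose_mul, Matrix.mul_assoc]

theorem hilbertSchmidt_self_eq_re_trace (A : Matrix m n ℂ) :
    hilbertSchmidt A A = (A * Aᴴ).trace.re := by
  rw [hilbertSchmidt_apply, Matrix.trace_mul_comm]

theorem hilbertSchmidt_self_eq_one {ρ : Matrix m m ℂ} (hρ : IsDensityMatrix ρ)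
    {A : Matrix m n ℂ} (hA : A * Aᴴ = ρ) : hilbertSchmidt A A = 1 := by
  rw [hilbertSchmidt_self_eq_re_trace, hA, hρ.2, Complex.one_re]

theorem re_trace_nonneg {A : Matrix n n ℂ} (hA : A.PosSemidef) : 0 ≤ A.trace.re :=
  (Complex.nonneg_iff.mp hA.trace_nonneg).1

theorem hilbertSchmidt_self_nonneg (A : Matrix m n ℂ) : 0 ≤ hilbertSchmidt A A :=
  re_trace_nonneg (Matrix.posSemidef_conjTranspose_mul_self A)

theorem hilbertSchmidt_self_eq_zero {A : Matrix m n ℂ} : hilbertSchmidt A A = 0 ↔ A = 0 := by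
  have htrace := (Matrix.posSemidef_conjTranspose_mul_self A).trace_nonneg
  rw [← Matrix.trace_conjTranspose_mul_self_eq_zero_iff, Complex.ext_iff, hilbertSchmidt_apply,
    ← (Complex.nonneg_iff.mp htrace).2]
  simp

theorem hilbertSchmidt_sq_le (A B : Matrix m n ℂ) :
    hilbertSchmidt A B ^ 2 ≤ hilbertSchmidt A A * hilbertSchmidt B B :=
  LinearMap.BilinForm.apply_sq_le_of_symm _ hilbertSchmidt_self_nonneg
    ⟨fun A B => hilbertSchmidt_comm A B⟩ A B

theorem hilbertSchmidt_add_self (A B : Matrix m n ℂ) :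
    hilbertSchmidt (A + B) (A + B) =
      hilbertSchmidt A A + hilbertSchmidt B B + 2 * hilbertSchmidt A B := by
  simp only [map_add, LinearMap.add_apply, hilbertSchmidt_comm B A]
  ring

theorem hilbertSchmidt_sub_self (A B : Matrix m n ℂ) :
    hilbertSchmidt (A - B) (A - B) =
      hilbertSchmidt A A + hilbertSchmidt B B - 2 * hilbertSchmidt A B := by
  simp only [map_sub, LinearMap.sub_apply, hilbertSchmidt_comm B A]
  ring

theorem hilbertSchmidt_unitary_mul [DecidableEq m] {U : Matrix m m ℂ}
    (hU : U ∈ Matrix.unitaryGroup m ℂ) (A B : Matrix m n ℂ) :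
    hilbertSchmidt (U * A) (U * B) = hilbertSchmidt A B := by
  have hUU : Uᴴ * U = 1 := Matrix.mem_unitaryGroup_iff'.mp hU
  rw [hilbertSchmidt_mul_left, ← Matrix.mul_assoc, hUU, Matrix.one_mul]

theorem hilbertSchmidt_mul_self_le [DecidableEq m] (X : Matrix m m ℂ) (A : Matrix m n ℂ) :
    hilbertSchmidt (X * A) (X * A) ≤ ‖X‖ ^ 2 * hilbertSchmidt A A := by
  have hX : star X * X ≤ algebraMap ℝ (Matrix m m ℂ) (‖X‖ ^ 2) :=
    CStarAlgebra.star_mul_le_algebraMap_norm_sq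
  have htrace := re_trace_nonneg ((Matrix.le_iff.mp hX).conjTranspose_mul_mul_same A)
  simpa [Algebra.algebraMap_eq_smul_one, hilbertSchmidt_apply, Matrix.mul_sub, Matrix.sub_mul,
    mul_assoc, Matrix.mul_assoc, Matrix.star_eq_conjTranspose, ← Complex.ofReal_pow] using htrace

variable [DecidableEq n]

theorem posSemidef_sqrt (A : Matrix n n ℂ) : (CFC.sqrt A).PosSemidef :=
  Matrix.nonneg_iff_posSemidef.mp (CFC.sqrt_nonneg A)

theorem conjTranspose_sqrt (A : Matrix n n ℂ) : (CFC.sqrt A)ᴴ = CFC.sqrt A :=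
  (posSemidef_sqrt A).1.eq

theorem sqrt_mul_conjTranspose_sqrt {P : Matrix n n ℂ} (hP : P.PosSemidef) :
    CFC.sqrt P * (CFC.sqrt P)ᴴ = P := by
  rw [conjTranspose_sqrt, CFC.sqrt_mul_sqrt_self P hP.nonneg]

theorem re_trace_mul_le_norm_mul_re_trace (C : Matrix n n ℂ) {P : Matrix n n ℂ}
    (hP : P.PosSemidef) : (C * P).trace.re ≤ ‖C‖ * P.trace.re := by
  set Q := CFC.sqrt P
  have hQQ : Q * Qᴴ = P := sqrt_mul_conjTranspose_sqrt hP
  have hQ : hilbertSchmidt Q Q = P.trace.re := by rw [hilbertSchmidt_self_eq_re_trace, hQQ]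
  have hCQ : hilbertSchmidt Q (C * Q) = (C * P).trace.re := by
    rw [hilbertSchmidt_apply, Matrix.trace_mul_comm, mul_assoc, hQQ]
  have hP0 := re_trace_nonneg hP
  refine le_of_sq_le_sq ?_ (by positivity)
  calc (C * P).trace.re ^ 2 = hilbertSchmidt Q (C * Q) ^ 2 := by rw [hCQ]
    _ ≤ hilbertSchmidt Q Q * hilbertSchmidt (C * Q) (C * Q) := hilbertSchmidt_sq_le _ _
    _ ≤ hilbertSchmidt Q Q * (‖C‖ ^ 2 * hilbertSchmidt Q Q) := by
      gcongr
      · exact hilbertSchmidt_self_nonneg Q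
      · exact hilbertSchmidt_mul_self_le C Q
    _ = (‖C‖ * P.trace.re) ^ 2 := by rw [hQ]; ring

/-! ### The polar decomposition -/

theorem exists_linearIsometry_apply_eq {𝕜 E F : Type*} [RCLike 𝕜] [AddCommGroup E] [Module 𝕜 E]
    [NormedAddCommGroup F] [InnerProductSpace 𝕜 F] [FiniteDimensional 𝕜 F] {f g : E →ₗ[𝕜] F}
    (h : ∀ x, ‖f x‖ = ‖g x‖) : ∃ W : F →ₗᵢ[𝕜] F, ∀ x, W (f x) = g x := by
  have hker : f.ker ≤ g.ker := fun x hx => by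
    rw [LinearMap.mem_ker] at hx ⊢
    rw [← norm_eq_zero, ← h, hx, norm_zero]
  let l : f.range →ₗ[𝕜] F := f.ker.liftQ g hker ∘ₗ f.quotKerEquivRange.symm.toLinearMap
  have hl (x) : l ⟨f x, x, rfl⟩ = g x := by
    have : f.quotKerEquivRange.symm ⟨f x, x, rfl⟩ = f.ker.mkQ x :=
      f.quotKerEquivRange_symm_apply_image x _
    simp [l, this]
  let L : f.range →ₗᵢ[𝕜] F := ⟨l, by rintro ⟨_, x, rfl⟩; rw [hl, ← h]; rfl⟩
  exact ⟨L.extend, fun x => (L.extend_apply ⟨f x, x, rfl⟩).trans (hl x)⟩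

theorem norm_toEuclideanCLM_apply_sq (M : Matrix n n ℂ) (x : EuclideanSpace ℂ n) :
    ‖Matrix.toEuclideanCLM (𝕜 := ℂ) M x‖ ^ 2 =
      (inner ℂ x (Matrix.toEuclideanCLM (𝕜 := ℂ) (Mᴴ * M) x)).re := by
  rw [← Matrix.star_eq_conjTranspose, map_mul, map_star, ContinuousLinearMap.star_eq_adjoint]
  exact ContinuousLinearMap.apply_norm_sq_eq_inner_adjoint_right _ x

theorem exists_unitary_mul_sqrt (M : Matrix n n ℂ) :
    ∃ W ∈ Matrix.unitaryGroup n ℂ, M = W * CFC.sqrt (Mᴴ * M) := by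
  let φ : Matrix n n ℂ ≃⋆ₐ[ℂ] _ := Matrix.toEuclideanCLM
  set P := CFC.sqrt (Mᴴ * M)
  have hPP : Pᴴ * P = Mᴴ * M := by
    rw [conjTranspose_sqrt]
    exact CFC.sqrt_mul_sqrt_self _ (Matrix.posSemidef_conjTranspose_mul_self M).nonneg
  have hnorm (x) : ‖φ P x‖ = ‖φ M x‖ := by
    rw [← sq_eq_sq₀ (norm_nonneg _) (norm_nonneg _), norm_toEuclideanCLM_apply_sq,
      norm_toEuclideanCLM_apply_sq, hPP]
  obtain ⟨W, hW⟩ := exists_linearIsometry_apply_eq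
    (f := (φ P).toLinearMap) (g := (φ M).toLinearMap) hnorm
  have hWW : star W.toContinuousLinearMap * W.toContinuousLinearMap = 1 :=
    (ContinuousLinearMap.norm_map_iff_adjoint_comp_self _).mp W.norm_map
  refine ⟨φ.symm W.toContinuousLinearMap, ?_, ?_⟩
  · rw [Matrix.mem_unitaryGroup_iff']
    apply EquivLike.injective φ
    rw [map_mul, map_star, φ.apply_symm_apply, map_one, hWW]
  · apply EquivLike.injective φ
    rw [map_mul, φ.apply_symm_apply]
    exact ContinuousLinearMap.ext fun x => (hW x).symm

/-! ### The trace norm -/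

theorem traceNorm_nonneg (X : Matrix n n ℂ) : 0 ≤ traceNorm X :=
  re_trace_nonneg (posSemidef_sqrt _)

theorem re_trace_mul_le_norm_mul_traceNorm (C X : Matrix n n ℂ) :
    (C * X).trace.re ≤ ‖C‖ * traceNorm X := by
  obtain ⟨W, hW, hX⟩ := exists_unitary_mul_sqrt X
  calc (C * X).trace.re = (C * W * CFC.sqrt (Xᴴ * X)).trace.re := by rw [mul_assoc, ← hX]
    _ ≤ ‖C * W‖ * traceNorm X := re_trace_mul_le_norm_mul_re_trace _ (posSemidef_sqrt _)
    _ = ‖C‖ * traceNorm X := by rw [CStarRing.norm_mul_mem_unitary C hW]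

theorem re_trace_mul_le_traceNorm {W : Matrix n n ℂ} (hW : W ∈ Matrix.unitaryGroup n ℂ)
    (X : Matrix n n ℂ) : (W * X).trace.re ≤ traceNorm X := by
  cases isEmpty_or_nonempty n
  · simp [traceNorm_nonneg]
  · simpa [CStarRing.norm_of_mem_unitary hW] using re_trace_mul_le_norm_mul_traceNorm W X

theorem exists_isHermitian_unitary_mul_eq_sqrt {X : Matrix n n ℂ} (hX : X.IsHermitian) :
    ∃ S ∈ Matrix.unitaryGroup n ℂ, S.IsHermitian ∧ S * X = CFC.sqrt (Xᴴ * X) := by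
  let sign : ℝ → ℝ := fun x => if 0 ≤ x then 1 else -1
  have hcont (f : ℝ → ℝ) : ContinuousOn f (spectrum ℝ X) :=
    Matrix.finite_real_spectrum.continuousOn f
  have hsign_mul_self (x) : sign x * sign x = 1 := by dsimp only [sign]; split_ifs <;> norm_num
  have hsign_mul (x) : sign x * x = ‖x‖ := by
    dsimp only [sign]
    split_ifs with hx
    · rw [one_mul, Real.norm_of_nonneg hx]
    · rw [neg_one_mul, Real.norm_of_nonpos (not_le.mp hx).le]
  have hS : star (cfc sign X) = cfc sign X := cfc_predicate sign X
  refine ⟨cfc sign X, Matrix.mem_unitaryGroup_iff.mpr ?_, hS, ?_⟩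
  · rw [hS, ← cfc_mul sign sign X (hcont _) (hcont _), funext hsign_mul_self, cfc_const_one ℝ X]
  · calc cfc sign X * X = cfc sign X * cfc id X := by rw [cfc_id ℝ X]
      _ = cfc (‖·‖) X := by
        rw [← cfc_mul sign id X (hcont _) (hcont _)]
        exact congrArg (cfc · X) (funext hsign_mul)
      _ = CFC.sqrt (Xᴴ * X) := (CFC.abs_eq_cfc_norm X).symm

theorem traceDistance_nonneg (ρ σ : Matrix n n ℂ) : 0 ≤ traceDistance ρ σ :=
  mul_nonneg (by norm_num) (traceNorm_nonneg _)

theorem abs_expectation_sub_le (H ρ σ : Matrix n n ℂ) :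
    |expectation H ρ - expectation H σ| ≤ 2 * ‖H‖ * traceDistance ρ σ := by
  have htraceNorm : 2 * ‖H‖ * traceDistance ρ σ = ‖H‖ * traceNorm (ρ - σ) := by
    rw [traceDistance]; ring
  rw [← expectation_sub, htraceNorm]
  refine abs_le'.mpr ⟨re_trace_mul_le_norm_mul_traceNorm H _, ?_⟩
  have hneg := re_trace_mul_le_norm_mul_traceNorm (-H) (ρ - σ)
  rwa [neg_mul, Matrix.trace_neg, Complex.neg_re, norm_neg] at hneg

theorem exists_expectation_sub_eq [Nonempty n] {ρ σ : Matrix n n ℂ} (hρ : ρ.IsHermitian)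
    (hσ : σ.IsHermitian) :
    ∃ S : Matrix n n ℂ, S.IsHermitian ∧ ‖S‖ = 1 ∧
      expectation S ρ - expectation S σ = 2 * traceDistance ρ σ := by
  obtain ⟨S, hSunitary, hS, hsqrt⟩ := exists_isHermitian_unitary_mul_eq_sqrt (hρ.sub hσ)
  refine ⟨S, hS, CStarRing.norm_of_mem_unitary hSunitary, ?_⟩
  rw [← expectation_sub, expectation, hsqrt, traceDistance, traceNorm]
  ring

/-! ### The fidelity -/

theorem fidelity_eq_traceNorm {ρ σ : Matrix n n ℂ} (hσ : σ.PosSemidef) :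
    fidelity ρ σ = traceNorm (CFC.sqrt σ * CFC.sqrt ρ) := by
  rw [fidelity, traceNorm, Matrix.conjTranspose_mul, conjTranspose_sqrt, conjTranspose_sqrt]
  simp only [mul_assoc, ← mul_assoc (CFC.sqrt σ) (CFC.sqrt σ),
    CFC.sqrt_mul_sqrt_self σ hσ.nonneg]

theorem exists_unitary_sqrt_mul (A : Matrix n n ℂ) :
    ∃ W ∈ Matrix.unitaryGroup n ℂ, A = CFC.sqrt (A * Aᴴ) * W := by
  obtain ⟨W, hW, hA⟩ := exists_unitary_mul_sqrt Aᴴ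
  refine ⟨Wᴴ, Unitary.star_mem hW, ?_⟩
  rw [Matrix.conjTranspose_conjTranspose] at hA
  simpa [conjTranspose_sqrt] using congrArg Matrix.conjTranspose hA

theorem hilbertSchmidt_le_fidelity (A B : Matrix n n ℂ) :
    hilbertSchmidt B A ≤ fidelity (A * Aᴴ) (B * Bᴴ) := by
  obtain ⟨W, hW, hA⟩ := exists_unitary_sqrt_mul A
  obtain ⟨W', hW', hB⟩ := exists_unitary_sqrt_mul B
  rw [fidelity_eq_traceNorm (Matrix.posSemidef_self_mul_conjTranspose B)]
  set P := CFC.sqrt (A * Aᴴ)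
  set Q := CFC.sqrt (B * Bᴴ)
  have hQ : Qᴴ = Q := conjTranspose_sqrt _
  calc hilbertSchmidt B A = (W * W'ᴴ * (Q * P)).trace.re := by
        rw [hilbertSchmidt_apply, hA, hB, Matrix.conjTranspose_mul, hQ, ← mul_assoc,
          Matrix.trace_mul_comm]
        simp only [mul_assoc]
    _ ≤ traceNorm (Q * P) := re_trace_mul_le_traceNorm (mul_mem hW (Unitary.star_mem hW')) _

theorem exists_hilbertSchmidt_eq_fidelity {ρ σ : Matrix n n ℂ} (hρ : ρ.PosSemidef)
    (hσ : σ.PosSemidef) :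
    ∃ A B : Matrix n n ℂ, A * Aᴴ = ρ ∧ B * Bᴴ = σ ∧ hilbertSchmidt B A = fidelity ρ σ := by
  obtain ⟨W, hW, hpolar⟩ := exists_unitary_mul_sqrt (CFC.sqrt σ * CFC.sqrt ρ)
  refine ⟨CFC.sqrt ρ, CFC.sqrt σ * W, sqrt_mul_conjTranspose_sqrt hρ, ?_, ?_⟩
  · have hWW : W * Wᴴ = 1 := Matrix.mem_unitaryGroup_iff.mp hW
    rw [Matrix.conjTranspose_mul, mul_assoc, ← mul_assoc W, hWW, one_mul,
      sqrt_mul_conjTranspose_sqrt hσ]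
  · have hWW : Wᴴ * W = 1 := Matrix.mem_unitaryGroup_iff'.mp hW
    rw [hilbertSchmidt_apply, Matrix.conjTranspose_mul, conjTranspose_sqrt,
      mul_assoc, hpolar, ← mul_assoc, hWW, one_mul, fidelity_eq_traceNorm hσ, traceNorm]

theorem fidelity_lt_one {ρ σ : Matrix n n ℂ} (hρ : IsDensityMatrix ρ) (hσ : IsDensityMatrix σ)
    (hne : ρ ≠ σ) : fidelity ρ σ < 1 := by
  obtain ⟨A, B, hA, hB, hF⟩ := exists_hilbertSchmidt_eq_fidelity hρ.1 hσ.1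
  have hAB : B - A ≠ 0 := fun h => hne (by rw [← hA, ← hB, sub_eq_zero.mp h])
  have hpos : 0 < hilbertSchmidt (B - A) (B - A) :=
    (hilbertSchmidt_self_nonneg _).lt_of_ne' (mt hilbertSchmidt_self_eq_zero.mp hAB)
  rw [hilbertSchmidt_sub_self, hilbertSchmidt_self_eq_one hρ hA,
    hilbertSchmidt_self_eq_one hσ hB, hF] at hpos
  linarith

theorem traceNorm_mul_conjTranspose_sub_sq_le (A B : Matrix n m ℂ) :
    traceNorm (A * Aᴴ - B * Bᴴ) ^ 2 ≤
      hilbertSchmidt (A + B) (A + B) * hilbertSchmidt (A - B) (A - B) := by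
  obtain ⟨S, hSunitary, hS, hsqrt⟩ := exists_isHermitian_unitary_mul_eq_sqrt
    ((Matrix.isHermitian_mul_conjTranspose_self A).sub
      (Matrix.isHermitian_mul_conjTranspose_self B))
  have hself (C : Matrix n m ℂ) : hilbertSchmidt (S * C) C = (S * (C * Cᴴ)).trace.re := by
    rw [hilbertSchmidt_mul_left, hS.eq, hilbertSchmidt_apply, Matrix.trace_mul_comm,
      Matrix.mul_assoc]
  have hcross : hilbertSchmidt (S * B) A = hilbertSchmidt (S * A) B := by
    rw [hilbertSchmidt_mul_left, hS.eq, hilbertSchmidt_comm]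
  have htraceNorm : traceNorm (A * Aᴴ - B * Bᴴ) = hilbertSchmidt (S * (A + B)) (A - B) := by
    rw [traceNorm, ← hsqrt, mul_sub, Matrix.trace_sub, Complex.sub_re, ← hself, ← hself,
      Matrix.mul_add, map_add, LinearMap.add_apply, map_sub, map_sub, hcross]
    ring
  rw [htraceNorm, ← hilbertSchmidt_unitary_mul hSunitary (A + B)]
  exact hilbertSchmidt_sq_le _ _

theorem traceDistance_le_sqrt {ρ σ : Matrix n n ℂ} (hρ : IsDensityMatrix ρ)
    (hσ : IsDensityMatrix σ) : traceDistance ρ σ ≤ √(1 - fidelity ρ σ ^ 2) := by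
  obtain ⟨A, B, hA, hB, hF⟩ := exists_hilbertSchmidt_eq_fidelity hρ.1 hσ.1
  have h := traceNorm_mul_conjTranspose_sub_sq_le A B
  rw [hilbertSchmidt_add_self, hilbertSchmidt_sub_self, hilbertSchmidt_comm A B, hF,
    hilbertSchmidt_self_eq_one hρ hA, hilbertSchmidt_self_eq_one hσ hB, hA, hB] at h
  rw [traceDistance]
  exact Real.le_sqrt_of_sq_le (by linarith)

theorem one_sub_fidelity_conj_le {ρ U : Matrix n n ℂ} (hρ : IsDensityMatrix ρ)
    (hU : U ∈ Matrix.unitaryGroup n ℂ) :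
    2 * (1 - fidelity ρ (U * ρ * Uᴴ)) ≤ ‖U - 1‖ ^ 2 := by
  set A := CFC.sqrt ρ
  have hA : A * Aᴴ = ρ := sqrt_mul_conjTranspose_sqrt hρ.1
  have hA1 : hilbertSchmidt A A = 1 := hilbertSchmidt_self_eq_one hρ hA
  have hUA : U * A * (U * A)ᴴ = U * ρ * Uᴴ := by
    rw [← hA, Matrix.conjTranspose_mul]
    noncomm_ring
  have hUA1 : hilbertSchmidt (U * A) (U * A) = 1 := by rw [hilbertSchmidt_unitary_mul hU, hA1]
  have hfidelity := hilbertSchmidt_le_fidelity A (U * A)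
  rw [hA, hUA] at hfidelity
  have hdist := hilbertSchmidt_mul_self_le (U - 1) A
  rw [sub_mul, one_mul, hilbertSchmidt_sub_self, hA1, hUA1, mul_one] at hdist
  linarith

/-! ### Lipschitz paths on the unit sphere -/

section Sphere

open InnerProductGeometry Filter Topology

variable {E : Type*} [NormedAddCommGroup E] [InnerProductSpace ℝ E]

theorem norm_sub_sq_eq_cos_angle {x y : E} (hx : ‖x‖ = 1) (hy : ‖y‖ = 1) :
    ‖x - y‖ ^ 2 = 2 * (1 - Real.cos (angle x y)) := by
  have hsub := norm_sub_sq_real x y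
  have hcos := cos_angle_mul_norm_mul_norm x y
  rw [hx, hy] at hsub hcos
  linarith

theorem angle_eq_two_mul_arcsin {x y : E} (hx : ‖x‖ = 1) (hy : ‖y‖ = 1) :
    angle x y = 2 * Real.arcsin (‖x - y‖ / 2) := by
  have hnonneg := angle_nonneg x y
  have hle_pi := angle_le_pi x y
  have hsin : ‖x - y‖ / 2 = Real.sin (angle x y / 2) := by
    have hsin_nonneg := Real.sin_nonneg_of_nonneg_of_le_pi
      (by linarith : 0 ≤ angle x y / 2) (by linarith)
    rw [← sq_eq_sq₀ (by positivity) hsin_nonneg, div_pow, norm_sub_sq_eq_cos_angle hx hy,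
      Real.sin_sq_eq_half_sub]
    ring_nf
  rw [hsin, Real.arcsin_sin (by linarith) (by linarith)]
  ring

theorem hasDerivAt_two_mul_arcsin (K t : ℝ) :
    HasDerivAt (fun s => 2 * Real.arcsin (K * (s - t) / 2)) K t := by
  have hinner : HasDerivAt (fun s => K * (s - t) / 2) (K / 2) t := by
    simpa using (((hasDerivAt_id t).sub_const t).const_mul K).div_const 2
  have harcsin : HasDerivAt Real.arcsin 1 (K * (t - t) / 2) := by
    simpa using Real.hasDerivAt_arcsin (x := 0) (by norm_num) (by norm_num)
  exact ((harcsin.comp t hinner).const_mul 2).congr_deriv (by ring)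

theorem angle_le_of_lipschitzOnWith {x : ℝ → E} {a b : ℝ} {K : NNReal} (hab : a ≤ b)
    (hnorm : ∀ t ∈ Icc a b, ‖x t‖ = 1) (hx : LipschitzOnWith K x (Icc a b)) :
    angle (x a) (x b) ≤ K * (b - a) := by
  have hne (t) (ht : t ∈ Icc a b) : x t ≠ 0 := norm_ne_zero_iff.mp (by simp [hnorm t ht])
  have ha : a ∈ Icc a b := left_mem_Icc.mpr hab
  have hcont : ContinuousOn (fun t => angle (x a) (x t)) (Icc a b) := fun t ht =>
    (continuousAt_angle (x := (x a, x t)) (hne a ha) (hne t ht)).comp_continuousWithinAt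
      (f := fun t => (x a, x t)) (continuousWithinAt_const.prodMk (hx.continuousOn t ht))
  -- Infinitesimally the angle `2 arcsin (‖x s - x t‖ / 2)` is the chord `‖x s - x t‖`.
  have hslope (t) (ht : t ∈ Ico a b) (r : ℝ) (hr : K < r) :
      ∃ᶠ s in 𝓝[>] t, slope (fun s => angle (x a) (x s)) t s < r := by
    have htendsto := (hasDerivAt_iff_tendsto_slope.mp (hasDerivAt_two_mul_arcsin K t)).mono_left
      (nhdsWithin_mono t fun s (hs : t < s) => hs.ne')
    refine Eventually.frequently ?_
    filter_upwards [htendsto.eventually_lt_const hr, Ioc_mem_nhdsGT ht.2] with s hs hst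
    refine lt_of_le_of_lt ?_ hs
    have hs' : s ∈ Icc a b := ⟨ht.1.trans hst.1.le, hst.2⟩
    have ht' : t ∈ Icc a b := ⟨ht.1, ht.2.le⟩
    have hchord : ‖x t - x s‖ ≤ K * (s - t) := by
      simpa [abs_of_neg (sub_neg.mpr hst.1)] using hx.norm_sub_le ht' hs'
    have hangle : angle (x t) (x s) ≤ 2 * Real.arcsin (K * (s - t) / 2) := by
      rw [angle_eq_two_mul_arcsin (hnorm t ht') (hnorm s hs')]
      gcongr
    have htriangle := angle_le_angle_add_angle (x a) (x t) (x s)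
    simp only [slope_def_field, sub_self, mul_zero, zero_div, Real.arcsin_zero, sub_zero]
    have := hst.1
    gcongr
    linarith
  refine image_le_of_liminf_slope_right_le_deriv_boundary hcont (B := fun t => K * (t - a))
    (B' := fun _ => K) ?_ (by fun_prop) (fun t _ => ?_) hslope (right_mem_Icc.mpr hab)
  · simp [angle_self (hne a ha)]
  · simpa using (((hasDerivAt_id t).sub_const a).const_mul (K : ℝ)).hasDerivWithinAt

end Sphere

/-! ### Propagators -/

section Propagator

open Filter

theorem absolutelyContinuousOnInterval_of_dist_le {X Y : Type*} [PseudoMetricSpace X]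
    [PseudoMetricSpace Y] {f : ℝ → X} {g : ℝ → Y} {a b K : ℝ}
    (hg : AbsolutelyContinuousOnInterval g a b)
    (hfg : ∀ s ∈ uIcc a b, ∀ t ∈ uIcc a b, dist (f s) (f t) ≤ K * dist (g s) (g t)) :
    AbsolutelyContinuousOnInterval f a b := by
  refine squeeze_zero' (.of_forall fun _ => Finset.sum_nonneg fun _ _ => dist_nonneg) ?_
    (by simpa using Tendsto.const_mul K hg)
  rw [eventually_inf_principal]
  filter_upwards with I hI
  rw [Finset.mul_sum]
  gcongr with i hi
  exact hfg _ (hI.1 i hi).1 _ (hI.1 i hi).2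

theorem absolutelyContinuousOnInterval_integral {E : Type*} [NormedAddCommGroup E]
    [NormedSpace ℝ E] {f : ℝ → E} {a b c : ℝ} (hf : IntervalIntegrable f volume a b)
    (hc : c ∈ uIcc a b) : AbsolutelyContinuousOnInterval (fun t => ∫ s in c..t, f s) a b := by
  refine absolutelyContinuousOnInterval_of_dist_le (K := 1)
    (hf.norm.absolutelyContinuousOnInterval_intervalIntegral hc) fun s hs t ht => ?_
  have hint (r) (hr : r ∈ uIcc a b) : IntervalIntegrable f volume c r :=
    hf.mono_set (uIcc_subset_uIcc hc hr)
  rw [dist_eq_norm, dist_eq_norm, one_mul,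
    intervalIntegral.integral_interval_sub_left (hint s hs) (hint t ht),
    intervalIntegral.integral_interval_sub_left (hint s hs).norm (hint t ht).norm]
  exact intervalIntegral.norm_integral_le_abs_integral_norm

theorem absolutelyContinuousOnInterval_star_mul_self {A : Type*} [NormedRing A] [StarRing A]
    [NormedStarGroup A] {f : ℝ → A} {a b : ℝ} (hf : AbsolutelyContinuousOnInterval f a b) :
    AbsolutelyContinuousOnInterval (fun t => star (f t) * f t) a b := by
  obtain ⟨C, hC⟩ := hf.exists_bound
  refine absolutelyContinuousOnInterval_of_dist_le (K := C + C) hf fun s hs t ht => ?_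
  simp only [dist_eq_norm]
  calc ‖star (f s) * f s - star (f t) * f t‖
      = ‖star (f s) * (f s - f t) + star (f s - f t) * f t‖ := by rw [star_sub]; noncomm_ring
    _ ≤ ‖star (f s)‖ * ‖f s - f t‖ + ‖star (f s - f t)‖ * ‖f t‖ :=
      (norm_add_le _ _).trans (add_le_add (norm_mul_le _ _) (norm_mul_le _ _))
    _ ≤ C * ‖f s - f t‖ + ‖f s - f t‖ * C := by
      rw [norm_star, norm_star]
      gcongr
      exacts [hC s hs, hC t ht]
    _ = (C + C) * ‖f s - f t‖ := by ring

variable {V U : ℝ → Matrix n n ℂ} {T : ℝ}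

theorem propagator_zero (hT : 0 ≤ T) (hU : IsTimeOrderedExp V U T) : U 0 = 1 := by
  simpa using hU.2 0 (left_mem_Icc.mpr hT)

theorem intervalIntegrable_mul_propagator (hT : 0 ≤ T) (hV : IntegrableOn V (Icc 0 T))
    (hU : IsTimeOrderedExp V U T) : IntervalIntegrable (fun t => V t * U t) volume 0 T := by
  rw [intervalIntegrable_iff_integrableOn_Icc_of_le hT]
  exact hV.mul_continuousOn hU.1 isCompact_Icc

theorem propagator_mem_unitaryGroup (hV : IntegrableOn V (Icc 0 T))
    (hVherm : ∀ t ∈ Icc 0 T, (V t).IsHermitian) (hU : IsTimeOrderedExp V U T)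
    {t : ℝ} (ht : t ∈ Icc 0 T) : U t ∈ Matrix.unitaryGroup n ℂ := by
  have hT := ht.1.trans ht.2
  have hVU := intervalIntegrable_mul_propagator hT hV hU
  rw [← uIcc_of_le hT] at ht
  -- The integral equation extends `U` to a function that is differentiable almost everywhere.
  let W : ℝ → Matrix n n ℂ := fun t => 1 - Complex.I • ∫ s in (0 : ℝ)..t, V s * U s
  have hUW (t) (ht : t ∈ uIcc 0 T) : U t = W t := hU.2 t (by rwa [uIcc_of_le hT] at ht)
  have hW : AbsolutelyContinuousOnInterval W 0 T :=
    absolutelyContinuousOnInterval_of_dist_le (K := 1)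
      (absolutelyContinuousOnInterval_integral hVU left_mem_uIcc) fun s _ t _ => by
        simp [W, dist_eq_norm, ← smul_sub, norm_smul, norm_sub_rev]
  have hderiv : ∀ᵐ t, t ∈ uIcc 0 T → HasDerivAt (fun t => star (W t) * W t) 0 t := by
    filter_upwards [hVU.ae_hasDerivAt_integral] with t hint ht
    have hVt : star (V t) = V t := hVherm t (by rwa [uIcc_of_le hT] at ht)
    have hWt : HasDerivAt W (-(Complex.I • (V t * U t))) t :=
      ((hint ht 0 left_mem_uIcc).const_smul Complex.I).const_sub 1
    refine (hWt.star.mul hWt).congr_deriv ?_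
    simp [hUW t ht, hVt, mul_assoc]
  obtain ⟨C, hC⟩ := (absolutelyContinuousOnInterval_star_mul_self hW).const_of_ae_hasDerivAt_zero
    hderiv
  rw [Matrix.mem_unitaryGroup_iff', hUW t ht, hC t ht, ← hC 0 left_mem_uIcc]
  simp [W]

theorem lipschitzOnWith_propagator {v : NNReal} (hV : IntegrableOn V (Icc 0 T))
    (hVherm : ∀ t ∈ Icc 0 T, (V t).IsHermitian) (hU : IsTimeOrderedExp V U T)
    (hv : ∀ t ∈ Icc 0 T, ‖V t‖ ≤ v) : LipschitzOnWith v U (Icc 0 T) := by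
  refine LipschitzOnWith.of_dist_le_mul fun s hs t ht => ?_
  have hT := hs.1.trans hs.2
  have hVU := intervalIntegrable_mul_propagator hT hV hU
  have hint (r) (hr : r ∈ Icc 0 T) : IntervalIntegrable (fun t => V t * U t) volume 0 r :=
    hVU.mono_set (uIcc_subset_uIcc left_mem_uIcc (by rwa [uIcc_of_le hT]))
  calc dist (U s) (U t) = ‖∫ r in s..t, V r * U r‖ := by
        rw [hU.2 s hs, hU.2 t ht, dist_eq_norm, sub_sub_sub_cancel_left, ← smul_sub, norm_smul,
          Complex.norm_I, one_mul,
          intervalIntegral.integral_interval_sub_left (hint t ht) (hint s hs)]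
    _ ≤ v * |t - s| := intervalIntegral.norm_integral_le_of_norm_le_const fun r hr => by
        have hr' : r ∈ Icc 0 T := uIcc_subset_Icc hs ht (uIoc_subset_uIcc hr)
        have hUr := propagator_mem_unitaryGroup hV hVherm hU hr'
        rw [CStarRing.norm_mul_mem_unitary _ hUr]
        exact hv r hr'
    _ = v * dist s t := by rw [Real.dist_eq, abs_sub_comm]

theorem norm_apply_of_mem_unitaryGroup {W : Matrix n n ℂ} (hW : W ∈ Matrix.unitaryGroup n ℂ)
    (x : EuclideanSpace ℂ n) : ‖Matrix.toEuclideanCLM (𝕜 := ℂ) W x‖ = ‖x‖ := by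
  have hWW : Wᴴ * W = 1 := Matrix.mem_unitaryGroup_iff'.mp hW
  rw [← sq_eq_sq₀ (norm_nonneg _) (norm_nonneg _), norm_toEuclideanCLM_apply_sq, hWW, map_one]
  exact inner_self_eq_norm_sq (𝕜 := ℂ) x

theorem norm_sub_sq_le_of_lipschitzOnWith {a b : ℝ} {v : NNReal} (hab : a ≤ b)
    (hU : ∀ t ∈ Icc a b, U t ∈ Matrix.unitaryGroup n ℂ) (hlip : LipschitzOnWith v U (Icc a b))
    (hv : v * (b - a) ≤ Real.pi) : ‖U b - U a‖ ^ 2 ≤ 2 * (1 - Real.cos (v * (b - a))) := by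
  let φ := Matrix.toEuclideanCLM (n := n) (𝕜 := ℂ)
  let _ : InnerProductSpace ℝ (EuclideanSpace ℂ n) := InnerProductSpace.rclikeToReal ℂ _
  have hcos := Real.cos_le_one (v * (b - a))
  have hchord (x : EuclideanSpace ℂ n) (hx : ‖x‖ = 1) :
      ‖φ (U b - U a) x‖ ≤ √(2 * (1 - Real.cos (v * (b - a)))) := by
    have hnorm (t) (ht : t ∈ Icc a b) : ‖φ (U t) x‖ = 1 := by
      rw [norm_apply_of_mem_unitaryGroup (hU t ht), hx]
    have horbit : LipschitzOnWith v (fun t => φ (U t) x) (Icc a b) :=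
      LipschitzOnWith.of_dist_le_mul fun s hs t ht => by
        rw [dist_eq_norm, ← sub_apply, ← map_sub]
        calc ‖φ (U s - U t) x‖ ≤ ‖φ (U s - U t)‖ * ‖x‖ := ContinuousLinearMap.le_opNorm _ _
          _ = dist (U s) (U t) := by rw [hx, mul_one, dist_eq_norm, Matrix.cstar_norm_def]
          _ ≤ v * dist s t := hlip.dist_le_mul s hs t ht
    have hangle := angle_le_of_lipschitzOnWith hab hnorm horbit
    have hle := Real.cos_le_cos_of_nonneg_of_le_pi
      (InnerProductGeometry.angle_nonneg _ _) hv hangle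
    have hsq := norm_sub_sq_eq_cos_angle (hnorm a (left_mem_Icc.mpr hab))
      (hnorm b (right_mem_Icc.mpr hab))
    rw [norm_sub_rev, ← sub_apply, ← map_sub] at hsq
    exact Real.le_sqrt_of_sq_le (by linarith)
  rw [← Real.le_sqrt (norm_nonneg _) (by linarith), Matrix.cstar_norm_def]
  exact ContinuousLinearMap.opNorm_le_of_unit_norm (Real.sqrt_nonneg _) hchord

end Propagator

/-! ### Logarithms of unitary matrices -/

section Logarithm

open selfAdjoint Unitary

theorem abs_arg_le_of_cos_le_re {z : ℂ} (hz : ‖z‖ = 1) {r : ℝ} (hr : 0 ≤ r)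
    (h : Real.cos r ≤ z.re) : |z.arg| ≤ r := by
  by_contra! hlt
  have hcos := Real.cos_lt_cos_of_nonneg_of_le_pi hr (Complex.abs_arg_le_pi z) hlt
  rw [Real.cos_abs, Complex.cos_arg (norm_ne_zero_iff.mp (by simp [hz])), hz, div_one] at hcos
  linarith

theorem norm_argSelfAdjoint_le {A : Type*} [CStarAlgebra A] {u : unitary A} {r : ℝ} (hr : 0 ≤ r)
    (h : ‖(u - 1 : A)‖ ^ 2 ≤ 2 * (1 - Real.cos r)) : ‖argSelfAdjoint u‖ ≤ r :=
  norm_cfc_le hr fun z hz => by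
    rw [Complex.norm_real]
    have hre := two_mul_one_sub_le_norm_sub_one_sq u.2 hz
    exact abs_arg_le_of_cos_le_re (spectrum.norm_eq_one_of_unitary u.2 hz) hr (by linarith)

theorem expUnitary_argSelfAdjoint_of_finite_spectrum {A : Type*} [CStarAlgebra A] {u : unitary A}
    (hu : (spectrum ℂ (u : A)).Finite) : expUnitary (argSelfAdjoint u) = u := by
  ext
  -- `arg` jumps at the eigenvalue `-1`, but every function is continuous on a finite spectrum.
  rw [expUnitary_coe, argSelfAdjoint_coe, ← CFC.exp_eq_normedSpace_exp (𝕜 := ℂ),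
    ← cfc_smul Complex.I _ _ (hu.continuousOn _),
    ← cfc_comp' NormedSpace.exp _ _ ((hu.image _).continuousOn _) (hu.continuousOn _)]
  conv_rhs => rw [← cfc_id' ℂ (u : A)]
  refine cfc_congr fun z hz => ?_
  have hz1 : ‖z‖ = 1 := spectrum.norm_eq_one_of_unitary u.2 hz
  simpa [← Complex.exp_eq_exp_ℂ, hz1, mul_comm] using Complex.norm_mul_exp_arg_mul_I z

end Logarithm

/-! ### Generators -/

section Generators

variable {ρ σ K : Matrix n n ℂ}

/-- The logarithms of the unitary conjugations from `ρ` to `σ`: the Hermitian `K` for which the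
constant Hamiltonian `K` takes `ρ` to `σ` in unit time. Their least norm is the charging
distance. -/
def generators (ρ σ : Matrix n n ℂ) : Set (Matrix n n ℂ) :=
  {K | K.IsHermitian ∧
    NormedSpace.exp (-Complex.I • K) * ρ * (NormedSpace.exp (-Complex.I • K))ᴴ = σ}

theorem expUnitary_neg_coe (hK : K.IsHermitian) :
    (selfAdjoint.expUnitary (-⟨K, hK⟩ : selfAdjoint (Matrix n n ℂ)) : Matrix n n ℂ) =
      NormedSpace.exp (-Complex.I • K) := by
  rw [selfAdjoint.expUnitary_coe]
  simp

theorem exists_mem_generators_norm_le_of_unitary {W : Matrix n n ℂ}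
    (hW : W ∈ Matrix.unitaryGroup n ℂ) (hWσ : W * ρ * Wᴴ = σ) :
    ∃ K ∈ generators ρ σ, ‖K‖ ≤ Real.pi ∧
      ∀ r, 0 ≤ r → ‖W - 1‖ ^ 2 ≤ 2 * (1 - Real.cos r) → ‖K‖ ≤ r := by
  let u : unitary (Matrix n n ℂ) := ⟨W, hW⟩
  let a := Unitary.argSelfAdjoint u
  have ha : (-a : Matrix n n ℂ).IsHermitian := (-a).2
  have hexp : NormedSpace.exp (-Complex.I • (-a : Matrix n n ℂ)) = W := by
    have := congrArg Subtype.val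
      (expUnitary_argSelfAdjoint_of_finite_spectrum (u := u) (Matrix.finite_spectrum W))
    rw [selfAdjoint.expUnitary_coe] at this
    rw [neg_smul_neg, this]
  refine ⟨-a, ⟨ha, by rw [hexp, hWσ]⟩, ?_, fun r hr hWr => ?_⟩
  · rw [norm_neg]
    exact Unitary.norm_argSelfAdjoint_le_pi u
  · rw [norm_neg]
    exact norm_argSelfAdjoint_le (u := u) hr hWr

theorem isClosed_generators (ρ σ : Matrix n n ℂ) : IsClosed (generators ρ σ) := by
  let _ : NormedAlgebra ℚ (Matrix n n ℂ) := NormedAlgebra.restrictScalars ℚ ℂ _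
  have hexp : Continuous fun K : Matrix n n ℂ => NormedSpace.exp (-Complex.I • K) :=
    NormedSpace.exp_continuous.comp (continuous_const_smul _)
  exact (isClosed_eq continuous_star continuous_id).inter
    (isClosed_eq ((hexp.mul continuous_const).mul hexp.star) continuous_const)

theorem exists_unitary_conj_eq (hρ : ρ.IsHermitian) (hσ : σ.IsHermitian)
    (hspec : ρ.charpoly = σ.charpoly) : ∃ W ∈ Matrix.unitaryGroup n ℂ, W * ρ * Wᴴ = σ := by
  let P := hρ.eigenvectorUnitary
  let Q := hσ.eigenvectorUnitary
  have hconj : Unitary.conjStarAlgAut ℂ (Matrix n n ℂ) (Q * star P) ρ = σ := by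
    conv_lhs => rw [hρ.spectral_theorem, (hρ.eigenvalues_eq_eigenvalues_iff hσ).mpr hspec]
    conv_rhs => rw [hσ.spectral_theorem]
    rw [← Unitary.conjStarAlgAut_mul_apply, mul_assoc, Unitary.star_mul_self, mul_one]
  exact ⟨(Q * star P : Matrix.unitaryGroup n ℂ), (Q * star P).2, hconj⟩

theorem generators_nonempty (hρ : ρ.IsHermitian) (hσ : σ.IsHermitian)
    (hspec : ρ.charpoly = σ.charpoly) : (generators ρ σ).Nonempty := by
  obtain ⟨W, hW, hWσ⟩ := exists_unitary_conj_eq hρ hσ hspec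
  obtain ⟨K, hK, -⟩ := exists_mem_generators_norm_le_of_unitary hW hWσ
  exact ⟨K, hK⟩

theorem ne_zero_of_mem_generators (hne : ρ ≠ σ) (hK : K ∈ generators ρ σ) : K ≠ 0 := by
  rintro rfl
  exact hne (by simpa using hK.2)

theorem arccos_fidelity_le_norm (hρ : IsDensityMatrix ρ) (hK : K ∈ generators ρ σ) :
    Real.arccos (fidelity ρ σ) ≤ ‖K‖ := by
  rcases le_total Real.pi ‖K‖ with hpi | hpi
  · exact (Real.arccos_le_pi _).trans hpi
  let u := selfAdjoint.expUnitary (-⟨K, hK.1⟩ : selfAdjoint (Matrix n n ℂ))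
  have hu : (u : Matrix n n ℂ) * ρ * (u : Matrix n n ℂ)ᴴ = σ := by
    rw [expUnitary_neg_coe]
    exact hK.2
  have hchord : ‖(u : Matrix n n ℂ) - 1‖ ^ 2 = 2 * (1 - Real.cos ‖K‖) := by
    have hnorm : ‖(-⟨K, hK.1⟩ : selfAdjoint (Matrix n n ℂ))‖ = ‖K‖ := norm_neg _
    rw [selfAdjoint.norm_sq_expUnitary_sub_one (hnorm.trans_le hpi), hnorm]
  have hfidelity := one_sub_fidelity_conj_le hρ u.2
  rw [hu, hchord] at hfidelity
  rw [← Real.arccos_cos (norm_nonneg K) hpi]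
  exact Real.arccos_le_arccos (by linarith)

end Generators

/-! ### The charging distance -/

section ChargingDistance

variable {ρ σ K : Matrix n n ℂ} {V : ℝ → Matrix n n ℂ} {T v : ℝ}

theorem isTimeOrderedExp_const (K : Matrix n n ℂ) (T : ℝ) :
    IsTimeOrderedExp (fun _ => K) (fun t => NormedSpace.exp (t • (-Complex.I • K))) T := by
  set X := -Complex.I • K with hX
  have hderiv (t : ℝ) :
      HasDerivAt (fun s : ℝ => NormedSpace.exp (s • X)) (X * NormedSpace.exp (t • X)) t :=
    hasDerivAt_exp_smul_const' X t
  have hcont : Continuous fun t : ℝ => NormedSpace.exp (t • X) :=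
    continuous_iff_continuousAt.mpr fun t => (hderiv t).continuousAt
  refine ⟨hcont.continuousOn, fun t _ => ?_⟩
  have hint := intervalIntegral.integral_eq_sub_of_hasDerivAt (a := 0) (b := t)
    (fun s _ => hderiv s) ((continuous_const.mul hcont).intervalIntegrable _ _)
  simp only [hX, Matrix.smul_mul, intervalIntegral.integral_smul, zero_smul,
    NormedSpace.exp_zero] at hint
  rw [neg_smul] at hint
  rw [sub_eq_add_neg, hint, hX, neg_smul]
  abel

theorem exists_drives_of_mem_generators (hne : ρ ≠ σ) (hK : K ∈ generators ρ σ) (hv : 0 < v) :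
    ∃ V, Drives V (‖K‖ / v) ρ σ ∧ ∀ t ∈ Icc 0 (‖K‖ / v), ‖V t‖ = v := by
  have hK0 : 0 < ‖K‖ := norm_pos_iff.mpr (ne_zero_of_mem_generators hne hK)
  refine ⟨fun _ => (v / ‖K‖) • K,
    ⟨by positivity, continuousOn_const.integrableOn_compact isCompact_Icc,
      fun _ _ => hK.1.smul (IsSelfAdjoint.all _), _, isTimeOrderedExp_const _ _, ?_⟩,
    fun _ _ => ?_⟩
  · have hscale : (‖K‖ / v) • -Complex.I • (v / ‖K‖) • K = -Complex.I • K := by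
      rw [smul_comm, smul_smul, div_mul_div_cancel₀ hv.ne', div_self hK0.ne', one_smul]
    rw [hscale]
    exact hK.2
  · rw [norm_smul, Real.norm_of_nonneg (by positivity), div_mul_cancel₀ _ hK0.ne']

theorem Drives.speed_nonneg (hV : Drives V T ρ σ) (hv : ∀ t ∈ Icc 0 T, ‖V t‖ ≤ v) : 0 ≤ v :=
  (norm_nonneg _).trans (hv 0 (left_mem_Icc.mpr hV.time_nonneg))

theorem Drives.exists_mem_generators_norm_le (hV : Drives V T ρ σ)
    (hv : ∀ t ∈ Icc 0 T, ‖V t‖ ≤ v) : ∃ K ∈ generators ρ σ, ‖K‖ ≤ v * T := by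
  have hT := hV.time_nonneg
  lift v to NNReal using hV.speed_nonneg hv
  obtain ⟨U, hU, hUσ⟩ := hV.reaches
  have hunitary (t) (ht : t ∈ Icc 0 T) : U t ∈ Matrix.unitaryGroup n ℂ :=
    propagator_mem_unitaryGroup hV.integrable hV.hermitian hU ht
  obtain ⟨K, hK, hKpi, hKle⟩ :=
    exists_mem_generators_norm_le_of_unitary (hunitary T (right_mem_Icc.mpr hT)) hUσ
  refine ⟨K, hK, ?_⟩
  rcases le_total (v * T) Real.pi with hvT | hvT
  · have hlip := lipschitzOnWith_propagator hV.integrable hV.hermitian hU hv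
    have hchord := norm_sub_sq_le_of_lipschitzOnWith hT hunitary hlip (by rwa [sub_zero])
    rw [propagator_zero hT hU, sub_zero] at hchord
    exact hKle _ (by positivity) hchord
  · exact hKpi.trans hvT

theorem exists_mem_generators_forall_norm_le (hρ : ρ.IsHermitian) (hσ : σ.IsHermitian)
    (hspec : ρ.charpoly = σ.charpoly) :
    ∃ K ∈ generators ρ σ, ∀ L ∈ generators ρ σ, ‖K‖ ≤ ‖L‖ := by
  have : ProperSpace (Matrix n n ℂ) := FiniteDimensional.proper ℂ _
  obtain ⟨K, hK, hdist⟩ := (isClosed_generators ρ σ).exists_infDist_eq_dist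
    (generators_nonempty hρ hσ hspec) 0
  refine ⟨K, hK, fun L hL => ?_⟩
  simpa [hdist] using Metric.infDist_le_dist_of_mem (x := 0) hL

theorem chargingDistance_le_norm (hne : ρ ≠ σ) (hK : K ∈ generators ρ σ) :
    chargingDistance ρ σ ≤ ‖K‖ :=
  csInf_le ⟨0, fun _ ⟨_, hV, _⟩ => hV.time_nonneg⟩
    (by simpa using exists_drives_of_mem_generators hne hK one_pos)

theorem exists_mem_generators_norm_eq_chargingDistance (hρ : ρ.IsHermitian) (hσ : σ.IsHermitian)
    (hspec : ρ.charpoly = σ.charpoly) (hne : ρ ≠ σ) :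
    ∃ K ∈ generators ρ σ, ‖K‖ = chargingDistance ρ σ := by
  obtain ⟨K, hK, hmin⟩ := exists_mem_generators_forall_norm_le hρ hσ hspec
  refine ⟨K, hK, (le_csInf ⟨‖K‖, ?_⟩ ?_).antisymm (chargingDistance_le_norm hne hK)⟩
  · simpa using exists_drives_of_mem_generators hne hK one_pos
  · rintro T ⟨V, hV, hVnorm⟩
    obtain ⟨L, hL, hLT⟩ := hV.exists_mem_generators_norm_le fun t ht => (hVnorm t ht).le
    linarith [hmin L hL]

theorem chargingDistance_pos (hρ : ρ.IsHermitian) (hσ : σ.IsHermitian)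
    (hspec : ρ.charpoly = σ.charpoly) (hne : ρ ≠ σ) : 0 < chargingDistance ρ σ := by
  obtain ⟨K, hK, hKD⟩ := exists_mem_generators_norm_eq_chargingDistance hρ hσ hspec hne
  exact hKD ▸ norm_pos_iff.mpr (ne_zero_of_mem_generators hne hK)

theorem Drives.chargingDistance_le (hne : ρ ≠ σ) (hV : Drives V T ρ σ)
    (hv : ∀ t ∈ Icc 0 T, ‖V t‖ ≤ v) : chargingDistance ρ σ ≤ v * T := by
  obtain ⟨K, hK, hKvT⟩ := hV.exists_mem_generators_norm_le hv
  exact (chargingDistance_le_norm hne hK).trans hKvT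

theorem Drives.time_pos (hne : ρ ≠ σ) (hV : Drives V T ρ σ) (hv : ∀ t ∈ Icc 0 T, ‖V t‖ ≤ v) :
    0 < T := by
  obtain ⟨K, hK, hKvT⟩ := hV.exists_mem_generators_norm_le hv
  have hvT := (norm_pos_iff.mpr (ne_zero_of_mem_generators hne hK)).trans_le hKvT
  exact pos_of_mul_pos_right hvT (hV.speed_nonneg hv)

theorem arccos_fidelity_le_chargingDistance (hρ : IsDensityMatrix ρ) (hσ : σ.IsHermitian)
    (hspec : ρ.charpoly = σ.charpoly) (hne : ρ ≠ σ) :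
    Real.arccos (fidelity ρ σ) ≤ chargingDistance ρ σ := by
  obtain ⟨K, hK, hKD⟩ := exists_mem_generators_norm_eq_chargingDistance hρ.1.1 hσ hspec hne
  exact hKD ▸ arccos_fidelity_le_norm hρ hK

end ChargingDistance

/-! ### The charging power -/

section Power

variable {ρ σ : Matrix n n ℂ} {T v : ℝ}

theorem meanPower_le (hD : 0 < chargingDistance ρ σ) (hT : 0 < T)
    (hDT : chargingDistance ρ σ ≤ v * T) (H : Matrix n n ℂ) :
    meanPower H ρ σ T ≤ 2 * ‖H‖ * v * (traceDistance ρ σ / chargingDistance ρ σ) := by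
  have hdist := traceDistance_nonneg ρ σ
  rw [meanPower, div_le_iff₀ hT]
  calc |expectation H ρ - expectation H σ| ≤ 2 * ‖H‖ * traceDistance ρ σ :=
        abs_expectation_sub_le H ρ σ
    _ = 2 * ‖H‖ * (traceDistance ρ σ / chargingDistance ρ σ) * chargingDistance ρ σ := by
      field_simp
    _ ≤ 2 * ‖H‖ * (traceDistance ρ σ / chargingDistance ρ σ) * (v * T) := by gcongr
    _ = 2 * ‖H‖ * v * (traceDistance ρ σ / chargingDistance ρ σ) * T := by ring

theorem exists_isHermitian_meanPower_eq [Nonempty n] (hρ : ρ.IsHermitian) (hσ : σ.IsHermitian)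
    {h : ℝ} (hh : 0 ≤ h) :
    ∃ H : Matrix n n ℂ, H.IsHermitian ∧ ‖H‖ = h ∧
      ∀ T, meanPower H ρ σ T = 2 * h * traceDistance ρ σ / T := by
  obtain ⟨S, hS, hSnorm, hSdist⟩ := exists_expectation_sub_eq hρ hσ
  refine ⟨h • S, hS.smul (IsSelfAdjoint.all h), by simp [norm_smul, hSnorm, hh], fun T => ?_⟩
  have hsmul (τ : Matrix n n ℂ) : expectation (h • S) τ = h * expectation S τ := by
    simp [expectation]
  have hdist := traceDistance_nonneg ρ σ
  rw [meanPower, hsmul, hsmul, ← mul_sub, hSdist, abs_of_nonneg (by positivity)]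
  ring

theorem exists_meanPower_eq [Nonempty n] (hρ : ρ.IsHermitian) (hσ : σ.IsHermitian)
    (hspec : ρ.charpoly = σ.charpoly) (hne : ρ ≠ σ) {h : ℝ} (hh : 0 ≤ h) (hv : 0 < v) :
    ∃ (H : Matrix n n ℂ) (V : ℝ → Matrix n n ℂ) (T : ℝ), H.IsHermitian ∧ ‖H‖ = h ∧
      Drives V T ρ σ ∧ (∀ t ∈ Icc 0 T, ‖V t‖ = v) ∧
      meanPower H ρ σ T = 2 * h * v * (traceDistance ρ σ / chargingDistance ρ σ) := by
  obtain ⟨H, hH, hHnorm, hpower⟩ := exists_isHermitian_meanPower_eq hρ hσ hh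
  obtain ⟨K, hK, hKD⟩ := exists_mem_generators_norm_eq_chargingDistance hρ hσ hspec hne
  obtain ⟨V, hV, hVnorm⟩ := exists_drives_of_mem_generators hne hK hv
  refine ⟨H, V, _, hH, hHnorm, hV, hVnorm, ?_⟩
  rw [hpower, hKD]
  field_simp

end Power

theorem sqrt_one_sub_sq_lt_arccos {x : ℝ} (hx : x < 1) : √(1 - x ^ 2) < Real.arccos x := by
  rw [← Real.sin_arccos]
  exact Real.sin_lt (Real.arccos_pos.mpr hx)

end QuantumCharging

theorem mainTheorem8 {n : Type*} [Fintype n] [DecidableEq n] (ρ σ : Matrix n n ℂ)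
    (hρ : QuantumCharging.IsDensityMatrix ρ) (hσ : QuantumCharging.IsDensityMatrix σ)
    (hspec : ρ.charpoly = σ.charpoly) (hne : ρ ≠ σ) :
    0 < QuantumCharging.chargingDistance ρ σ ∧
    -- the bound on the mean power, and its comparison with the bound `2 ‖H‖ ‖V‖`
    (∀ (H : Matrix n n ℂ) (V : ℝ → Matrix n n ℂ) (T v : ℝ), H.IsHermitian →
      QuantumCharging.Drives V T ρ σ → (∀ t ∈ Set.Icc 0 T, ‖V t‖ ≤ v) →
        0 < T ∧
        QuantumCharging.meanPower H ρ σ T ≤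
          2 * ‖H‖ * v *
            (QuantumCharging.traceDistance ρ σ / QuantumCharging.chargingDistance ρ σ) ∧
        2 * ‖H‖ * v *
            (QuantumCharging.traceDistance ρ σ / QuantumCharging.chargingDistance ρ σ) ≤
          2 * ‖H‖ * v) ∧
    -- the bound is attained for all prescribed operator norms of `H` and `V`
    (∀ h v : ℝ, 0 ≤ h → 0 < v →
      ∃ (H : Matrix n n ℂ) (V : ℝ → Matrix n n ℂ) (T : ℝ), H.IsHermitian ∧ ‖H‖ = h ∧
        QuantumCharging.Drives V T ρ σ ∧ (∀ t ∈ Set.Icc 0 T, ‖V t‖ = v) ∧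
        QuantumCharging.meanPower H ρ σ T =
          2 * h * v *
            (QuantumCharging.traceDistance ρ σ / QuantumCharging.chargingDistance ρ σ)) ∧
    -- the ratio of the distances
    0 < Real.arccos (QuantumCharging.fidelity ρ σ) ∧
    QuantumCharging.traceDistance ρ σ / QuantumCharging.chargingDistance ρ σ ≤
      √(1 - QuantumCharging.fidelity ρ σ ^ 2) / Real.arccos (QuantumCharging.fidelity ρ σ) ∧
    √(1 - QuantumCharging.fidelity ρ σ ^ 2) / Real.arccos (QuantumCharging.fidelity ρ σ) < 1 := by
  have := hρ.nonempty
  have hD := QuantumCharging.chargingDistance_pos hρ.1.1 hσ.1.1 hspec hne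
  have hF := QuantumCharging.fidelity_lt_one hρ hσ hne
  have harccos : 0 < Real.arccos (QuantumCharging.fidelity ρ σ) := Real.arccos_pos.mpr hF
  have hratio := div_le_div₀ (Real.sqrt_nonneg _) (QuantumCharging.traceDistance_le_sqrt hρ hσ)
    harccos (QuantumCharging.arccos_fidelity_le_chargingDistance hρ hσ.1.1 hspec hne)
  have hratio_lt := (div_lt_one harccos).mpr (QuantumCharging.sqrt_one_sub_sq_lt_arccos hF)
  refine ⟨hD, fun H V T v _ hV hv => ?_, fun h v hh hv => ?_, harccos, hratio, hratio_lt⟩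
  · have hT := hV.time_pos hne hv
    have hv0 := hV.speed_nonneg hv
    exact ⟨hT, QuantumCharging.meanPower_le hD hT (hV.chargingDistance_le hne hv) H,
      mul_le_of_le_one_right (by positivity) (hratio.trans hratio_lt.le)⟩
  · exact QuantumCharging.exists_meanPower_eq hρ.1.1 hσ.1.1 hspec hne hh hv
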